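/- Let $Y_1,Y_2,\ldots$ be independent random variables with values in $\{0,1\}$ and $p_\ell=\mathbb P(Y_\ell=1)\in(0,1)$, where the sequence $p_1,p_2,\ldots$ is periodic with minimal period $r$. Let $d\ge 1$ be an integer and let $r$ and $d$ share a common divisor greater than $1$. For $1\le i\le d$ put $$Z_i^n=\frac1{\lfloor n/d\rfloor}\sum_{k=0}^{\lfloor n/d\rfloor-1}Y_{i+kd},$$ and for every integer $i\ge1$ put $$e_i=\frac1r\sum_{k=0}^{r-1}p_{i+kd},\qquad v_i=\frac1r\sum_{k=0}^{r-1}\mathrm{Var}(Y_{i+kd}).$$ Let $q=\lfloor (d-1)/2\rfloor$ and $\omega_j=2\pi j/d$. For $x\in\mathbb R^d$ let $I_x(\omega_j)=\frac1d\bigl|\sum_{\ell=1}^d x_\ell e^{-i\ell\omega_j}\bigr|^2$, $$A=\{x\in\mathbb R^d: I_x(\omega_1)=\dots=I_x(\omega_q)=0\},\qquad g(x)=\frac{\max_{1\le j\le q}I_x(\omega_j)}{\sum_{m=1}^q I_x(\omega_m)}\quad(x\notin A),$$ with $g(x)=0$ for $x\in A$ by convention (if $d\le 2$, then $q=0$ and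 $A=\mathbb R^d$), and let $f(x)=g(x)\mathbf 1_{\{x\notin A\}}$. Write $Z^n=(Z_1^n,\dots,Z_d^n)$. (a) If $r=2$, then $(e_1,\ldots,e_d)\in A$, and for i.i.d. standard normal random variables $N_1,\dots,N_d$, as $n\to\infty$, $$f(Z^n)\to g\bigl(\sqrt{v_1}N_1,\sqrt{v_2}N_2,\sqrt{v_1}N_3,\ldots,\sqrt{v_2}N_d\bigr)\quad\text{in law;}$$ moreover, if $d\ge3$, the argument of $g$ on the right lies outside $A$ almost surely. (b) If $r\ge3$, $b=\gcd(r,d)\ge 3$ and $$\sum_{k=1}^r e_k\exp\Bigl(-\frac{2\pi i k}{b}\Bigr)\Bigl(\Bigl\lfloor\frac{d-k}{r}\Bigr\rfloor+1\Bigr)\ne0,$$ then $(e_1,\ldots,e_d)\notin A$ and $f(Z^n)\to g(e_1,\ldots,e_d)$ in probability as $n\to\infty$. -/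

import Mathlib

open MeasureTheory ProbabilityTheory Filter
open scoped Topology

noncomputable section

namespace PeriodTest

/-- `q = ⌊(d - 1) / 2⌋`, the number of Fourier frequencies in `(0, π)` for a series of
length `d`. -/
def numFreq (d : ℕ) : ℕ := (d - 1) / 2

/-- The `j`-th Fourier frequency `ω_j = 2 π j / d`. -/
def freq (d j : ℕ) : ℝ := 2 * Real.pi * j / d

/-- The periodogram `I_x(ω) = (1 / d) |∑_{ℓ=1}^d x_ℓ exp(-i ℓ ω)|²` of a series
`x = (x_1, …, x_d)`; the entry `x_ℓ` is `x ⟨ℓ - 1, _⟩`. -/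
def periodogram {d : ℕ} (x : Fin d → ℝ) (ω : ℝ) : ℝ :=
  1 / (d : ℝ) *
    ‖∑ l : Fin d, (x l : ℂ) * Complex.exp (-(Complex.I * (((l : ℕ) + 1 : ℕ) : ℂ) * (ω : ℂ)))‖ ^ 2

/-- Fisher's statistic `g(x) = max_{1 ≤ j ≤ q} I_x(ω_j) / ∑_{1 ≤ m ≤ q} I_x(ω_m)`.
The supremum is over a finite set, hence a maximum if `q ≥ 1`; the value is `0` if `q = 0`
or if the denominator vanishes. -/
def fisherG {d : ℕ} (x : Fin d → ℝ) : ℝ :=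
  (⨆ j : Finset.Icc 1 (numFreq d), periodogram x (freq d j)) /
    ∑ m ∈ Finset.Icc 1 (numFreq d), periodogram x (freq d m)

/-- The set `A` of all series with `I_x(ω_1) = … = I_x(ω_q) = 0`. -/
def setA (d : ℕ) : Set (Fin d → ℝ) :=
  {x | ∀ j ∈ Finset.Icc 1 (numFreq d), periodogram x (freq d j) = 0}

/-- The test statistic `f = g · 1_{Aᶜ}`. -/
def testStat {d : ℕ} (x : Fin d → ℝ) : ℝ := (setA d)ᶜ.indicator fisherG x

/-- `r` is the minimal period of the sequence `p_1, p_2, …` (the value `p 0` plays no role). -/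
def IsMinimalPeriod (p : ℕ → ℝ) (r : ℕ) : Prop :=
  IsLeast {s : ℕ | 0 < s ∧ ∀ l m : ℕ, 1 ≤ l → p (m * s + l) = p l} r

/-- `Z_i^n = (1 / ⌊n/d⌋) ∑_{k=0}^{⌊n/d⌋-1} Y_{i+kd}`. -/
def blockMean {Ω : Type*} (Y : ℕ → Ω → ℝ) (d n i : ℕ) (ω : Ω) : ℝ :=
  1 / ((n / d : ℕ) : ℝ) * ∑ k ∈ Finset.range (n / d), Y (i + k * d) ω

/-- The series `Z^n = (Z_1^n, …, Z_d^n)`. -/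
def blockSeries {Ω : Type*} (Y : ℕ → Ω → ℝ) (d n : ℕ) (ω : Ω) : Fin d → ℝ :=
  fun i => blockMean Y d n ((i : ℕ) + 1) ω

/-- `e_i = (1 / r) ∑_{k=0}^{r-1} p_{i+kd}`. -/
def limMean (p : ℕ → ℝ) (r d i : ℕ) : ℝ :=
  1 / (r : ℝ) * ∑ k ∈ Finset.range r, p (i + k * d)

/-- The vector `(e_1, …, e_d)`. -/
def limSeries (p : ℕ → ℝ) (r d : ℕ) : Fin d → ℝ :=
  fun i => limMean p r d ((i : ℕ) + 1)

/-- `v_i = (1 / r) ∑_{j=0}^{r-1} Var(Y_{i+jd})`. -/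
def limVar {Ω : Type*} [MeasurableSpace Ω] (P : Measure Ω) (Y : ℕ → Ω → ℝ) (r d i : ℕ) : ℝ :=
  1 / (r : ℝ) * ∑ j ∈ Finset.range r, variance (Y (i + j * d)) P

/-- The vector `(s x_1, t x_2, s x_3, t x_4, …)`: odd-numbered entries (even `Fin` index) are
multiplied by `s`, even-numbered ones by `t`. -/
def altScale {d : ℕ} (s t : ℝ) (x : Fin d → ℝ) : Fin d → ℝ :=
  fun i => (if Even (i : ℕ) then s else t) * x i

end PeriodTest

end

/-!
Fisher's `g` is continuous off `A`, and it is invariant under translation by elements of `A` and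
under scaling. The block means converge in probability to `e`, so everything depends on whether
`e ∈ A`.

If `r = 2`, the sequence `e` has period `2`, so its Fourier sums vanish at all frequencies in
`(0, π)` and `e ∈ A`. Invariance then replaces the block means by their fluctuations
`√m (Z - e)`, where `m = ⌊n / d⌋`. These converge in law to a Gaussian vector, because the `d`
blocks are independent and, as `2 ∣ d`, each of them is i.i.d. The Gaussian vector avoids `A`
almost surely: a linear combination of independent atomless variables, not all of whose
coefficients vanish, is almost surely nonzero. So the continuous mapping theorem applies to `g`.

If `b = gcd(r, d) ≥ 3`, then `ω_{d/b} = 2π / b` is one of the frequencies in question. Collecting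
the terms of the Fourier sum of `e` at this frequency by their residue class mod `r` gives the
displayed sum, so `e ∉ A` and `g` is continuous at `e`.
-/

namespace PeriodTest

section PeriodicSequences

lemma periodic_of_dvd {α : Type*} {a : ℕ → α} {r d : ℕ} (ha : Function.Periodic a r)
    (hrd : r ∣ d) : Function.Periodic a d := by
  obtain ⟨c, rfl⟩ := hrd
  simpa only [smul_eq_mul, mul_comm] using ha.nsmul c

lemma sum_range_add_of_periodic {M : Type*} [AddCommMonoid M] {a : ℕ → M} {r : ℕ}
    (ha : Function.Periodic a r) (m : ℕ) :
    ∑ k ∈ Finset.range r, a (m + k) = ∑ k ∈ Finset.range r, a k := by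
  induction m with
  | zero => simp only [zero_add]
  | succ m ih =>
    rw [← ih]
    cases r with
    | zero => rfl
    | succ r =>
      rw [Finset.sum_range_succ, Finset.sum_range_succ', add_zero, ← ha m]
      simp only [add_assoc, add_comm 1]

lemma sum_range_eq_sum_count_modEq {M : Type*} [AddCommMonoid M] {a : ℕ → M} {r : ℕ}
    (ha : Function.Periodic a r) (hr : 0 < r) (n : ℕ) :
    ∑ l ∈ Finset.range n, a l = ∑ k ∈ Finset.range r, n.count (· ≡ k [MOD r]) • a k := by
  rw [← Finset.sum_fiberwise_of_maps_to (g := (· % r))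
    fun l _ => Finset.mem_range.2 (Nat.mod_lt l hr)]
  refine Finset.sum_congr rfl fun k hk => ?_
  have hmod : ∀ l, l ≡ k [MOD r] ↔ l % r = k := fun l => by
    rw [Nat.ModEq, Nat.mod_eq_of_lt (Finset.mem_range.1 hk)]
  simp only [Nat.count_eq_card_filter_range, hmod]
  refine Finset.sum_eq_card_nsmul fun l hl => ?_
  rw [← (Finset.mem_filter.1 hl).2, ha.map_mod_nat]

lemma tendsto_count_modEq_div {r : ℕ} (hr : 0 < r) (k : ℕ) :
    Tendsto (fun m : ℕ => (m.count (· ≡ k [MOD r]) : ℝ) / m) atTop (𝓝 (1 / r)) := by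
  have hdiv : Tendsto (fun m : ℕ => ((m / r : ℕ) : ℝ) / m) atTop (𝓝 (1 / r)) := by
    refine ((tendsto_nat_floor_mul_div_atTop (R := ℝ) (a := 1 / r) (by positivity)).comp
      tendsto_natCast_atTop_atTop).congr fun m => ?_
    simp only [Function.comp_apply, one_div_mul_eq_div, Nat.floor_div_natCast, Nat.floor_natCast]
  have hrem : Tendsto (fun m : ℕ => ((if k % r < m % r then 1 else 0 : ℕ) : ℝ) / m) atTop
      (𝓝 0) := by
    refine squeeze_zero (fun m => by positivity) (fun m => ?_) tendsto_one_div_atTop_nhds_zero_nat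
    gcongr
    split_ifs <;> simp
  simpa only [Nat.count_modEq_card _ hr, Nat.cast_add, add_div, add_zero] using hdiv.add hrem

lemma tendsto_average_of_periodic {a : ℕ → ℝ} {r : ℕ} (ha : Function.Periodic a r) (hr : 0 < r) :
    Tendsto (fun m : ℕ => 1 / (m : ℝ) * ∑ k ∈ Finset.range m, a k) atTop
      (𝓝 (1 / (r : ℝ) * ∑ k ∈ Finset.range r, a k)) := by
  rw [Finset.mul_sum]
  refine (tendsto_finsetSum _ fun k _ => (tendsto_count_modEq_div hr k).mul_const (a k)).congr
    fun m => ?_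
  rw [sum_range_eq_sum_count_modEq ha hr, Finset.mul_sum]
  exact Finset.sum_congr rfl fun k _ => by rw [nsmul_eq_mul]; ring

lemma floor_sub_div_add_one_eq_count_modEq {r k : ℕ} (hk : k < r) (d : ℕ) :
    ⌊((d : ℝ) - (k + 1 : ℕ)) / r⌋ + 1 = d.count (· ≡ k [MOD r]) := by
  have hr : 0 < r := by omega
  have hshift : ((d : ℝ) - (k + 1 : ℕ)) / r + 1 = ((d + (r - (k + 1)) : ℕ) : ℝ) / r := by
    have hk' : k + 1 ≤ r := hk
    push_cast [Nat.cast_sub hk']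
    field_simp
    ring
  have hlt : r - (k + 1) < r := by omega
  have hcarry : r ≤ d % r + (r - (k + 1)) ↔ k < d % r := by omega
  rw [← Int.floor_add_one, hshift, Int.floor_div_natCast, Int.floor_natCast, ← Int.natCast_ediv,
    Nat.add_div hr, Nat.count_modEq_card _ hr, Nat.div_eq_of_lt hlt, Nat.mod_eq_of_lt hlt,
    Nat.mod_eq_of_lt hk, add_zero]
  simp only [hcarry]

/-- Shifting the index by `r` multiplies the sum by `z ^ r`, but permutes its terms cyclically. -/
lemma sum_range_mul_pow_eq_zero_of_periodic {R : Type*} [CommRing R] [IsDomain R] {a : ℕ → R}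
    {r d : ℕ} {z : R} (ha : Function.Periodic a r) (hrd : r ∣ d) (hzd : z ^ d = 1)
    (hzr : z ^ r ≠ 1) : ∑ l ∈ Finset.range d, a l * z ^ (l + 1) = 0 := by
  have hper : Function.Periodic (fun l => a l * z ^ (l + 1)) d := fun l => by
    simp only [periodic_of_dvd ha hrd l, add_right_comm _ d, pow_add z _ d, hzd, mul_one]
  have hshift : (∑ l ∈ Finset.range d, a l * z ^ (l + 1)) * z ^ r =
      ∑ l ∈ Finset.range d, a l * z ^ (l + 1) := by
    conv_rhs => rw [← sum_range_add_of_periodic hper r]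
    rw [Finset.sum_mul]
    refine Finset.sum_congr rfl fun l _ => ?_
    rw [add_comm r l, ha l]
    ring
  exact (mul_right_eq_self₀.1 hshift).resolve_left hzr

end PeriodicSequences

section Periodogram

variable {d : ℕ}

/-- The Fourier sum `∑_{ℓ=1}^d x_ℓ exp(-i ℓ ω)` whose squared modulus is `d` times the periodogram,
as a linear map of the series `x`. -/
noncomputable def fourierSum (d : ℕ) (ω : ℝ) : (Fin d → ℝ) →ₗ[ℝ] ℂ :=
  Fintype.linearCombination ℝ fun l : Fin d => Complex.exp (-(Complex.I * ω)) ^ ((l : ℕ) + 1)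

lemma fourierSum_apply_eq_sum_range (ω : ℝ) (a : ℕ → ℝ) :
    fourierSum d ω (fun i => a i) =
      ∑ l ∈ Finset.range d, (a l : ℂ) * Complex.exp (-(Complex.I * ω)) ^ (l + 1) := by
  simp only [fourierSum, Fintype.linearCombination_apply, Complex.real_smul]
  exact Fin.sum_univ_eq_sum_range
    (fun l => (a l : ℂ) * Complex.exp (-(Complex.I * ω)) ^ (l + 1)) d

lemma freq_div {b : ℕ} (hd : d ≠ 0) (hbd : b ∣ d) : freq d (d / b) = 2 * Real.pi / b := by
  have hd' : (d : ℝ) ≠ 0 := Nat.cast_ne_zero.2 hd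
  rw [freq, Nat.cast_div_charZero hbd]
  field_simp

lemma exp_neg_freq_pow_eq_one_iff (hd : d ≠ 0) (j n : ℕ) :
    Complex.exp (-(Complex.I * freq d j)) ^ n = 1 ↔ d ∣ j * n := by
  have hroot : Complex.exp (-(Complex.I * freq d j)) =
      (Complex.exp (2 * Real.pi * Complex.I / d))⁻¹ ^ j := by
    rw [← Complex.exp_neg, ← Complex.exp_nat_mul, freq]
    congr 1
    push_cast
    ring
  rw [hroot, ← pow_mul, (Complex.isPrimitiveRoot_exp d hd).inv.pow_eq_one_iff_dvd]

lemma periodogram_eq_norm_fourierSum (x : Fin d → ℝ) (ω : ℝ) :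
    periodogram x ω = 1 / (d : ℝ) * ‖fourierSum d ω x‖ ^ 2 := by
  simp only [periodogram, fourierSum, Fintype.linearCombination_apply, Complex.real_smul,
    ← Complex.exp_nat_mul]
  congr! 6 with l
  ring

lemma continuous_periodogram (ω : ℝ) : Continuous fun x : Fin d → ℝ => periodogram x ω := by
  unfold periodogram
  fun_prop

lemma periodogram_nonneg (x : Fin d → ℝ) (ω : ℝ) : 0 ≤ periodogram x ω := by
  unfold periodogram
  positivity

lemma periodogram_eq_zero_iff {x : Fin d → ℝ} {ω : ℝ} :
    periodogram x ω = 0 ↔ fourierSum d ω x = 0 := by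
  rw [periodogram_eq_norm_fourierSum]
  rcases eq_or_ne d 0 with rfl | hd
  · simp [Subsingleton.elim x 0, -Matrix.zero_empty]
  · simp [hd]

lemma periodogram_smul_sub {e : Fin d → ℝ} {ω : ℝ} (he : periodogram e ω = 0) (c : ℝ)
    (z : Fin d → ℝ) : periodogram (c • (z - e)) ω = c ^ 2 * periodogram z ω := by
  simp only [periodogram_eq_norm_fourierSum, map_smul, map_sub, periodogram_eq_zero_iff.1 he,
    sub_zero, norm_smul, mul_pow, Real.norm_eq_abs, sq_abs]
  ring

end Periodogram

section FisherStatistic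

variable {d : ℕ} {x : Fin d → ℝ}

lemma mem_setA_iff :
    x ∈ setA d ↔ ∀ j ∈ Finset.Icc 1 (numFreq d), fourierSum d (freq d j) x = 0 :=
  forall₂_congr fun _ _ => periodogram_eq_zero_iff

lemma sum_periodogram_eq_zero_iff :
    ∑ m ∈ Finset.Icc 1 (numFreq d), periodogram x (freq d m) = 0 ↔ x ∈ setA d :=
  Finset.sum_eq_zero_iff_of_nonneg fun _ _ => periodogram_nonneg _ _

/-- On `A` the denominator of `g` vanishes, so there the value of `fisherG` is `x / 0 = 0`. -/
lemma testStat_eq_fisherG (x : Fin d → ℝ) : testStat x = fisherG x := by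
  by_cases hx : x ∈ setA d
  · simp [testStat, hx, fisherG, sum_periodogram_eq_zero_iff.2 hx]
  · simp [testStat, hx]

lemma fisherG_smul_sub {e : Fin d → ℝ} (he : e ∈ setA d) {c : ℝ} (hc : c ≠ 0) (z : Fin d → ℝ) :
    fisherG (c • (z - e)) = fisherG z := by
  have hnum : ⨆ j : Finset.Icc 1 (numFreq d), periodogram (c • (z - e)) (freq d j) =
      c ^ 2 * ⨆ j : Finset.Icc 1 (numFreq d), periodogram z (freq d j) := by
    rw [Real.mul_iSup_of_nonneg (sq_nonneg c)]
    exact iSup_congr fun j => periodogram_smul_sub (he j j.2) c z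
  have hden : ∑ m ∈ Finset.Icc 1 (numFreq d), periodogram (c • (z - e)) (freq d m) =
      c ^ 2 * ∑ m ∈ Finset.Icc 1 (numFreq d), periodogram z (freq d m) := by
    rw [Finset.mul_sum]
    exact Finset.sum_congr rfl fun j hj => periodogram_smul_sub (he j hj) c z
  rw [fisherG, hnum, hden, mul_div_mul_left _ _ (pow_ne_zero 2 hc), fisherG]

lemma measurable_fisherG : Measurable (fisherG : (Fin d → ℝ) → ℝ) :=
  (Measurable.iSup fun _ => (continuous_periodogram _).measurable).div
    (Finset.measurable_fun_sum _ fun _ _ => (continuous_periodogram _).measurable)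

lemma continuousAt_fisherG (hx : x ∉ setA d) : ContinuousAt fisherG x := by
  have hne : Nonempty (Finset.Icc 1 (numFreq d)) := by
    by_contra hempty
    exact hx fun j hj => (hempty ⟨⟨j, hj⟩⟩).elim
  have hnum : Continuous fun y : Fin d → ℝ =>
      ⨆ j : Finset.Icc 1 (numFreq d), periodogram y (freq d j) := by
    simp_rw [← Finset.sup'_univ_eq_ciSup]
    exact Continuous.finset_sup'_apply _ fun j _ => continuous_periodogram _
  have hden : Continuous fun y : Fin d → ℝ =>
      ∑ m ∈ Finset.Icc 1 (numFreq d), periodogram y (freq d m) :=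
    continuous_finsetSum _ fun m _ => continuous_periodogram _
  exact hnum.continuousAt.div hden.continuousAt (mt sum_periodogram_eq_zero_iff.1 hx)

lemma fisherG_eq_zero_of_lt_three (hd : d < 3) (x : Fin d → ℝ) : fisherG x = 0 := by
  have hq : numFreq d = 0 := by
    rw [numFreq]
    omega
  simp [fisherG, hq]

lemma mem_setA_of_periodic_two {a : ℕ → ℝ} (ha : Function.Periodic a 2) (hd : 2 ∣ d) :
    (fun i : Fin d => a i) ∈ setA d := by
  refine mem_setA_iff.2 fun j hj => ?_
  rw [Finset.mem_Icc, numFreq] at hj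
  have hd0 : d ≠ 0 := by omega
  rw [fourierSum_apply_eq_sum_range]
  refine sum_range_mul_pow_eq_zero_of_periodic (ha.comp ((↑) : ℝ → ℂ)) hd ?_ ?_
  · exact (exp_neg_freq_pow_eq_one_iff hd0 j d).2 (dvd_mul_left d j)
  · rw [Ne, exp_neg_freq_pow_eq_one_iff hd0]
    exact Nat.not_dvd_of_pos_of_lt (by omega) (by omega)

lemma testStat_blockSeries_eq {Ω : Type*} {Y : ℕ → Ω → ℝ} {e : Fin d → ℝ} (he : e ∈ setA d)
    (n : ℕ) (ω : Ω) :
    testStat (blockSeries Y d n ω) = fisherG fun i : Fin d => (√((n / d : ℕ) : ℝ))⁻¹ *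
      (∑ k ∈ Finset.range (n / d), Y ((i : ℕ) + 1 + k * d) ω - (n / d : ℕ) * e i) := by
  rw [testStat_eq_fisherG]
  rcases Nat.eq_zero_or_pos (n / d) with h | h
  · congr 1
    ext i
    simp [blockSeries, blockMean, h]
  · have hm : (0 : ℝ) < (n / d : ℕ) := Nat.cast_pos.2 h
    have hne : √((n / d : ℕ) : ℝ) ≠ 0 := (Real.sqrt_pos.2 hm).ne'
    rw [← fisherG_smul_sub he hne]
    congr 1
    ext i
    simp only [Pi.smul_apply, Pi.sub_apply, smul_eq_mul, blockSeries, blockMean]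
    rw [eq_inv_mul_iff_mul_eq₀ hne, ← mul_assoc, Real.mul_self_sqrt hm.le]
    field_simp

lemma altScale_eq_mul_of_periodic {a : ℕ → ℝ} (ha : Function.Periodic a 2) (x : Fin d → ℝ) :
    altScale (a 0) (a 1) x = fun i : Fin d => a i * x i := by
  ext i
  rw [altScale, ← ha.map_mod_nat i]
  rcases Nat.mod_two_eq_zero_or_one i with h | h <;> simp [h, Nat.even_iff]

end FisherStatistic

section LimitSeries

variable {p : ℕ → ℝ} {r d : ℕ}

lemma periodic_apply_add_mul {α : Type*} {u : ℕ → α}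
    (hu : Function.Periodic (fun l => u (l + 1)) r) (i d : ℕ) :
    Function.Periodic (fun k => u (i + 1 + k * d)) r := fun k => by
  have h : u (i + k * d + d * r + 1) = u (i + k * d + 1) := hu.nat_mul d (i + k * d)
  convert h using 2 <;> ring

lemma limMean_periodic (hp : Function.Periodic (fun l => p (l + 1)) r) (s d : ℕ) :
    Function.Periodic (fun i => limMean p s d (i + 1)) r := fun i => by
  have h : ∀ k, p (i + r + 1 + k * d) = p (i + 1 + k * d) := fun k => by
    have hk : p (i + k * d + r + 1) = p (i + k * d + 1) := hp (i + k * d)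
    convert hk using 2 <;> ring
  simp only [limMean, h]

lemma limMean_eq_of_dvd (hp : Function.Periodic (fun l => p (l + 1)) r) (hr : r ≠ 0)
    (hrd : r ∣ d) (i : ℕ) : limMean p r d (i + 1) = p (i + 1) := by
  have h : ∀ k, p (i + 1 + k * d) = p (i + 1) := fun k => by
    have := (periodic_of_dvd hp hrd).nat_mul k i
    rwa [add_right_comm]
  simp only [limMean, h, Finset.sum_const, Finset.card_range, nsmul_eq_mul, one_div]
  exact inv_mul_cancel_left₀ (Nat.cast_ne_zero.2 hr) _

lemma fourierSum_limSeries (hp : Function.Periodic (fun l => p (l + 1)) r) (hr : 0 < r) {ω : ℝ}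
    (hω : Complex.exp (-(Complex.I * ω)) ^ r = 1) :
    fourierSum d ω (limSeries p r d) =
      ∑ k ∈ Finset.Icc 1 r, (limMean p r d k : ℂ) * Complex.exp (-(Complex.I * ω)) ^ k *
        ((⌊((d : ℝ) - (k : ℝ)) / (r : ℝ)⌋ + 1 : ℤ) : ℂ) := by
  set z := Complex.exp (-(Complex.I * ω))
  have hper : Function.Periodic (fun l => (limMean p r d (l + 1) : ℂ) * z ^ (l + 1)) r :=
    fun l => by
      have he : limMean p r d (l + r + 1) = limMean p r d (l + 1) := limMean_periodic hp r d l
      simp only [he, pow_add, hω, mul_one]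
  calc fourierSum d ω (limSeries p r d)
      = ∑ l ∈ Finset.range d, (limMean p r d (l + 1) : ℂ) * z ^ (l + 1) :=
        fourierSum_apply_eq_sum_range ω fun l => limMean p r d (l + 1)
    _ = ∑ k ∈ Finset.range r, d.count (· ≡ k [MOD r]) •
          ((limMean p r d (k + 1) : ℂ) * z ^ (k + 1)) :=
        sum_range_eq_sum_count_modEq hper hr d
    _ = ∑ k ∈ Finset.range r, (limMean p r d (k + 1) : ℂ) * z ^ (k + 1) *
          ((⌊((d : ℝ) - (k + 1 : ℕ)) / (r : ℝ)⌋ + 1 : ℤ) : ℂ) := by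
        refine Finset.sum_congr rfl fun k hk => ?_
        rw [floor_sub_div_add_one_eq_count_modEq (Finset.mem_range.1 hk), nsmul_eq_mul, mul_comm,
          Int.cast_natCast]
    _ = _ := by
        rw [Finset.range_eq_Ico, ← Finset.Ico_add_one_right_eq_Icc]
        exact Finset.sum_Ico_add' (fun k : ℕ => (limMean p r d k : ℂ) * z ^ k *
          ((⌊((d : ℝ) - (k : ℝ)) / (r : ℝ)⌋ + 1 : ℤ) : ℂ)) 0 r 1

lemma limSeries_notMem_setA (hp : Function.Periodic (fun l => p (l + 1)) r)
    (hd : d ≠ 0) (hb : 3 ≤ Nat.gcd r d)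
    (hne : ∑ k ∈ Finset.Icc 1 r,
        (limMean p r d k : ℂ) *
          Complex.exp (-(2 * (Real.pi : ℂ) * Complex.I * (k : ℂ) / (Nat.gcd r d : ℂ))) *
          ((⌊((d : ℝ) - (k : ℝ)) / (r : ℝ)⌋ + 1 : ℤ) : ℂ) ≠ 0) :
    limSeries p r d ∉ setA d := by
  have hr : 0 < r := Nat.pos_of_ne_zero <| by
    rintro rfl
    exact hne (by simp)
  have hbd := Nat.gcd_dvd_right r d
  have hbr := Nat.gcd_dvd_left r d
  set b := Nat.gcd r d
  have hmem : d / b ∈ Finset.Icc 1 (numFreq d) := by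
    have h1 : 1 ≤ d / b := Nat.div_pos (Nat.le_of_dvd (Nat.pos_of_ne_zero hd) hbd) (by omega)
    have h2 : d / b ≤ d / 3 := Nat.div_le_div_left hb three_pos
    rw [Finset.mem_Icc, numFreq]
    omega
  have hpow : ∀ k : ℕ, Complex.exp (-(Complex.I * freq d (d / b))) ^ k =
      Complex.exp (-(2 * (Real.pi : ℂ) * Complex.I * (k : ℂ) / (b : ℂ))) := fun k => by
    rw [← Complex.exp_nat_mul, freq_div hd hbd]
    congr 1
    push_cast
    ring
  have hroot : Complex.exp (-(Complex.I * freq d (d / b))) ^ r = 1 :=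
    (exp_neg_freq_pow_eq_one_iff hd _ r).2 <|
      (Nat.div_mul_cancel hbd).symm.dvd.trans (mul_dvd_mul_left _ hbr)
  intro hA
  have hzero := mem_setA_iff.1 hA (d / b) hmem
  rw [fourierSum_limSeries hp hr hroot] at hzero
  simp only [hpow] at hzero
  exact hne hzero

lemma limSeries_two_mem_setA (hp : Function.Periodic (fun l => p (l + 1)) 2) (hd : 2 ∣ d) :
    limSeries p 2 d ∈ setA d :=
  mem_setA_of_periodic_two (a := fun i => limMean p 2 d (i + 1)) (limMean_periodic hp 2 d) hd

lemma altScale_sqrt_limVar {Ω : Type*} [MeasurableSpace Ω] {P : Measure Ω} {Y : ℕ → Ω → ℝ}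
    (hvar : Function.Periodic (fun l => Var[Y (l + 1); P]) 2) (hd : 2 ∣ d) (x : Fin d → ℝ) :
    altScale √(limVar P Y 2 d 1) √(limVar P Y 2 d 2) x =
      fun i : Fin d => √(Var[Y (i + 1); P]) * x i := by
  have hlim : ∀ i, limVar P Y 2 d (i + 1) = Var[Y (i + 1); P] :=
    limMean_eq_of_dvd (p := fun l => Var[Y l; P]) hvar two_ne_zero hd
  rw [hlim 0, hlim 1]
  exact altScale_eq_mul_of_periodic (hvar.comp Real.sqrt) x

end LimitSeries

section LawOfLargeNumbers

variable {Ω : Type*} [MeasurableSpace Ω] {P : Measure Ω}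

lemma tendstoInMeasure_of_tendsto_variance [IsFiniteMeasure P] {κ : Type*} {l : Filter κ}
    {M : κ → Ω → ℝ} {e : ℝ} (hM : ∀ n, MemLp (M n) 2 P)
    (hmean : Tendsto (fun n => P[M n]) l (𝓝 e)) (hvar : Tendsto (fun n => Var[M n; P]) l (𝓝 0)) :
    TendstoInMeasure P M l fun _ => e := by
  rw [tendstoInMeasure_iff_norm]
  intro ε hε
  have hbound : Tendsto (fun n => ENNReal.ofReal (Var[M n; P] / (ε / 2) ^ 2)) l (𝓝 0) := by
    simpa using ENNReal.tendsto_ofReal (hvar.div_const ((ε / 2) ^ 2))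
  refine tendsto_of_tendsto_of_tendsto_of_le_of_le' tendsto_const_nhds hbound
    (.of_forall fun _ => zero_le) ?_
  filter_upwards [Metric.tendsto_nhds.1 hmean (ε / 2) (half_pos hε)] with n hn
  refine (measure_mono fun ω hω => ?_).trans (meas_ge_le_variance_div_sq (hM n) (half_pos hε))
  simp only [Set.mem_ofPred_eq, Real.norm_eq_abs, Real.dist_eq] at hω hn ⊢
  linarith [abs_sub_le (M n ω) (P[M n]) e]

lemma tendstoInMeasure_average [IsFiniteMeasure P] {X : ℕ → Ω → ℝ} {e v : ℝ}
    (hX : ∀ k, MemLp (X k) 2 P) (hind : Pairwise fun j k => IndepFun (X j) (X k) P)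
    (hmean : Tendsto (fun m : ℕ => 1 / (m : ℝ) * ∑ k ∈ Finset.range m, P[X k]) atTop (𝓝 e))
    (hvar : Tendsto (fun m : ℕ => 1 / (m : ℝ) * ∑ k ∈ Finset.range m, Var[X k; P]) atTop (𝓝 v)) :
    TendstoInMeasure P (fun (m : ℕ) ω => 1 / (m : ℝ) * ∑ k ∈ Finset.range m, X k ω) atTop
      fun _ => e := by
  refine tendstoInMeasure_of_tendsto_variance
    (fun m => (memLp_finsetSum _ fun k _ => hX k).const_mul _) (hmean.congr fun m => ?_) ?_
  · rw [integral_const_mul, integral_finsetSum _ fun k _ => (hX k).integrable one_le_two]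
  · have hprod := tendsto_one_div_atTop_nhds_zero_nat.mul hvar
    rw [zero_mul] at hprod
    refine hprod.congr fun m => ?_
    rw [variance_const_mul, ← IndepFun.variance_sum (fun k _ => hX k) (hind.set_pairwise _),
      Finset.sum_fn]
    ring

lemma tendstoInMeasure_comp_of_continuousAt {ι κ E : Type*} [Finite ι] [PseudoEMetricSpace E]
    {l : Filter κ} {U : κ → ι → Ω → ℝ} {e : ι → ℝ} {g : (ι → ℝ) → E} (hg : ContinuousAt g e)
    (hU : ∀ i, TendstoInMeasure P (fun n => U n i) l fun _ => e i) :
    TendstoInMeasure P (fun n ω => g (fun i => U n i ω)) l fun _ => g e := by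
  have := Fintype.ofFinite ι
  intro ε hε
  obtain ⟨δ, hδ, hball⟩ :=
    (Metric.nhds_basis_eball.tendsto_iff Metric.nhds_basis_eball).1 hg ε hε
  have hsum : Tendsto (fun n => ∑ i, P {ω | δ ≤ edist (U n i ω) (e i)}) l (𝓝 0) := by
    simpa using tendsto_finsetSum Finset.univ fun i _ => hU i δ hδ
  refine tendsto_of_tendsto_of_tendsto_of_le_of_le tendsto_const_nhds hsum
    (fun _ => zero_le) fun n => (measure_mono fun ω hω => ?_).trans (measure_iUnion_fintype_le P _)
  by_contra hfar
  simp only [Set.mem_iUnion, Set.mem_ofPred_eq, not_exists, not_le] at hfar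
  have hnear : (fun i => U n i ω) ∈ Metric.eball e δ := by
    rw [Metric.mem_eball, edist_pi_def, Finset.sup_lt_iff hδ]
    exact fun i _ => hfar i
  exact absurd (show ε ≤ _ from hω) (not_le.2 (hball _ hnear))

end LawOfLargeNumbers

section Independence

variable {Ω ι κ E : Type*} [MeasurableSpace Ω] [MeasurableSpace E] {P : Measure Ω}

lemma iIndepFun_curry [Countable ι] [Countable κ] {X : ι × κ → Ω → E}
    (hX : ∀ q, AEMeasurable (X q) P) (hind : iIndepFun X P) :
    iIndepFun (fun i ω k => X (i, k) ω) P := by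
  have := hind.isProbabilityMeasure
  have _ q := Measure.isProbabilityMeasure_map (hX q)
  have hrow : ∀ i, P.map (fun ω k => X (i, k) ω) =
      Measure.infinitePi fun k => P.map (X (i, k)) := fun i =>
    (hind.precomp (Prod.mk_right_injective i)).map_fun_eq_infinitePi_map₀' fun k => hX (i, k)
  rw [iIndepFun_iff_map_fun_eq_infinitePi_map₀' fun i => aemeasurable_pi_iff.2 fun k => hX (i, k)]
  simp only [hrow]
  rw [← Measure.infinitePi_map_curry (fun i k => P.map (X (i, k))),
    ← hind.map_fun_eq_infinitePi_map₀' hX, AEMeasurable.map_map_of_aemeasurable]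
  · rfl
  · exact (MeasurableEquiv.curry ι κ E).measurable.aemeasurable
  · exact aemeasurable_pi_iff.2 hX

end Independence

section ConvergenceInDistribution

variable {κ Ω' : Type*} {l : Filter κ} {Ω : κ → Type*} [∀ n, MeasurableSpace (Ω n)]
  [MeasurableSpace Ω'] {P : (n : κ) → Measure (Ω n)} [∀ n, IsProbabilityMeasure (P n)]
  {P' : Measure Ω'} [IsProbabilityMeasure P']

lemma tendstoInDistribution_pi {ι : Type*} [Finite ι] {U : (n : κ) → ι → Ω n → ℝ}
    {N : ι → Ω' → ℝ} (hU : ∀ i, TendstoInDistribution (fun n => U n i) l (N i) P P')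
    (hUi : ∀ n, iIndepFun (U n) (P n)) (hNi : iIndepFun N P') :
    TendstoInDistribution (fun n ω i => U n i ω) l (fun ω i => N i ω) P P' where
  forall_aemeasurable n := aemeasurable_pi_lambda _ fun i => (hU i).forall_aemeasurable n
  aemeasurable_limit := aemeasurable_pi_lambda _ fun i => (hU i).aemeasurable_limit
  tendsto := by
    have := Fintype.ofFinite ι
    have h := (ProbabilityMeasure.continuous_pi.tendsto _).comp
      (tendsto_pi_nhds.2 fun i => (hU i).tendsto)
    refine le_trans (h.congr fun n => Subtype.ext ?_) (le_of_eq (congrArg 𝓝 (Subtype.ext ?_)))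
    · exact ((hUi n).map_fun_eq_pi_map fun i => (hU i).forall_aemeasurable n).symm
    · exact (hNi.map_fun_eq_pi_map fun i => (hU i).aemeasurable_limit).symm

lemma tendstoInDistribution_comp_of_ae_continuousAt [l.IsCountablyGenerated]
    {E F : Type*} [TopologicalSpace E]
    [MeasurableSpace E] [BorelSpace E] [HasOuterApproxClosed E] [TopologicalSpace F]
    [MeasurableSpace F] [BorelSpace F] {U : (n : κ) → Ω n → E} {N : Ω' → E} {g : E → F}
    (hg : Measurable g) (hU : TendstoInDistribution U l N P P')
    (hgN : ∀ᵐ ω ∂P', ContinuousAt g (N ω)) :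
    TendstoInDistribution (fun n ω => g (U n ω)) l (fun ω => g (N ω)) P P' where
  forall_aemeasurable n := hg.comp_aemeasurable (hU.forall_aemeasurable n)
  aemeasurable_limit := hg.comp_aemeasurable hU.aemeasurable_limit
  tendsto := by
    refine tendsto_of_forall_isOpen_le_liminf' fun G hG => ?_
    have hO : IsOpen (interior (g ⁻¹' G)) := isOpen_interior
    have hgU : ∀ n, AEMeasurable (fun ω => g (U n ω)) (P n) := fun n =>
      hg.comp_aemeasurable (hU.forall_aemeasurable n)
    have hgN' : AEMeasurable (fun ω => g (N ω)) P' := hg.comp_aemeasurable hU.aemeasurable_limit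
    have hportmanteau := ProbabilityMeasure.le_liminf_measure_open_of_tendsto hU.tendsto hO
    simp only [ProbabilityMeasure.coe_mk] at hportmanteau ⊢
    rw [Measure.map_apply_of_aemeasurable hU.aemeasurable_limit hO.measurableSet] at hportmanteau
    rw [Measure.map_apply_of_aemeasurable hgN' hG.measurableSet]
    refine (measure_mono_ae ?_).trans
      (hportmanteau.trans (liminf_le_liminf (.of_forall fun n => ?_)))
    · filter_upwards [hgN] with ω hω hmem
      exact mem_interior_iff_mem_nhds.2 (hω.preimage_mem_nhds (hG.mem_nhds hmem))
    · rw [Measure.map_apply_of_aemeasurable (hgU n) hG.measurableSet,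
        Measure.map_apply_of_aemeasurable (hU.forall_aemeasurable n) hO.measurableSet]
      exact measure_mono (Set.preimage_mono (f := U n) interior_subset)

lemma tendstoInDistribution_comp_tendsto {κ' : Type*} {l' : Filter κ'} {E : Type*}
    [TopologicalSpace E] [MeasurableSpace E] [OpensMeasurableSpace E] {U : (n : κ) → Ω n → E}
    {N : Ω' → E} (hU : TendstoInDistribution U l N P P') {φ : κ' → κ} (hφ : Tendsto φ l' l) :
    TendstoInDistribution (fun n => U (φ n)) l' N (fun n => P (φ n)) P' where
  forall_aemeasurable n := hU.forall_aemeasurable (φ n)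
  aemeasurable_limit := hU.aemeasurable_limit
  tendsto := hU.tendsto.comp hφ

end ConvergenceInDistribution

section CentralLimitTheorem

variable {Ω Ω' ι : Type*} [MeasurableSpace Ω] [MeasurableSpace Ω'] [Finite ι]
  {P : Measure Ω} {P' : Measure Ω'} [IsProbabilityMeasure P] [IsProbabilityMeasure P']

lemma tendstoInDistribution_inv_sqrt_mul_sum_sub_pi {X : ι → ℕ → Ω → ℝ} {N : ι → Ω' → ℝ}
    (hX : ∀ i, MemLp (X i 0) 2 P) (hind : iIndepFun (fun q : ι × ℕ => X q.1 q.2) P)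
    (hident : ∀ i k, IdentDistrib (X i k) (X i 0) P P)
    (hN : ∀ i, HasLaw (N i) (gaussianReal 0 1) P') (hNi : iIndepFun N P') :
    TendstoInDistribution
      (fun (m : ℕ) ω i => (√(m : ℝ))⁻¹ * (∑ k ∈ Finset.range m, X i k ω - m * P[X i 0]))
      atTop (fun ω i => √(Var[X i 0; P]) * N i ω) (fun _ => P) P' := by
  refine tendstoInDistribution_pi (U := fun (m : ℕ) i ω =>
    (√(m : ℝ))⁻¹ * (∑ k ∈ Finset.range m, X i k ω - m * P[X i 0]))
    (N := fun i ω => √(Var[X i 0; P]) * N i ω) (fun i => ?_) (fun m => ?_) ?_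
  · refine tendstoInDistribution_inv_sqrt_mul_sum_sub ?_ (hX i)
      (hind.precomp (g := Prod.mk i) (Prod.mk_right_injective i)) (hident i)
    convert gaussianReal_const_mul (hN i) √(Var[X i 0; P]) using 2
    · rw [mul_zero]
    · ext
      simp [Real.sq_sqrt, variance_nonneg]
  · exact (iIndepFun_curry (fun q => (hident q.1 q.2).aemeasurable_fst) hind).comp
      (fun i x => (√(m : ℝ))⁻¹ * (∑ k ∈ Finset.range m, x k - m * P[X i 0])) fun i => by fun_prop
  · exact hNi.comp (fun i x => √(Var[X i 0; P]) * x) fun i => by fun_prop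

end CentralLimitTheorem

section Atomless

variable {Ω : Type*} [MeasurableSpace Ω] {P : Measure Ω}

lemma ae_ne_of_indepFun {E : Type*} [MeasurableSpace E] [MeasurableEq E] {U V : Ω → E}
    [IsFiniteMeasure P] (hU : AEMeasurable U P) (hV : AEMeasurable V P) (hUV : IndepFun U V P)
    [NullSingletonClass (P.map V)] : ∀ᵐ ω ∂P, U ω ≠ V ω := by
  have hdiag : MeasurableSet (Set.diagonal E) := measurableSet_diagonal
  have hnull : (P.map U).prod (P.map V) (Set.diagonal E) = 0 := by
    rw [Measure.measure_prod_null hdiag]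
    refine ae_of_all _ fun u => ?_
    simp [Set.preimage, Set.diagonal]
  rw [← (indepFun_iff_map_prod_eq_prod_map_map hU hV).1 hUV,
    Measure.map_apply_of_aemeasurable (hU.prodMk hV) hdiag] at hnull
  exact measure_mono_null (fun ω hω => not_not.1 hω) hnull

lemma ae_sum_smul_ne_zero {ι E : Type*} [Fintype ι] [AddCommGroup E] [Module ℝ E]
    {N : ι → Ω → ℝ} (hN : ∀ i, AEMeasurable (N i) P) (hind : iIndepFun N P) {v : ι → E} {i : ι}
    (hv : v i ≠ 0) [NullSingletonClass (P.map (N i))] : ∀ᵐ ω ∂P, ∑ j, N j ω • v j ≠ 0 := by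
  classical
  have := hind.isProbabilityMeasure
  obtain ⟨φ, hφ⟩ : ∃ φ : Module.Dual ℝ E, φ (v i) ≠ 0 := by
    by_contra! h
    exact hv ((Module.forall_dual_apply_eq_zero_iff ℝ _).1 h)
  set U : Ω → ℝ := fun ω => -(∑ j : ↥(Finset.univ.erase i), N j ω * φ (v j)) / φ (v i)
  have hUm : AEMeasurable U P := by fun_prop
  have hUN : IndepFun U (N i) P := by
    have hcomp := hind.indepFun_finset₀ (Finset.univ.erase i) {i} (by simp) hN
    exact hcomp.comp
      (φ := fun y : ↥(Finset.univ.erase i) → ℝ => -(∑ j, y j * φ (v j)) / φ (v i))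
      (ψ := fun y : ({i} : Finset ι) → ℝ => y ⟨i, Finset.mem_singleton_self i⟩)
      (by fun_prop) (by fun_prop)
  filter_upwards [ae_ne_of_indepFun hUm (hN i) hUN] with ω hω hsum
  refine hω ((div_eq_iff hφ).2 (neg_eq_of_add_eq_zero_right ?_))
  have hφsum := congrArg φ hsum
  simp only [map_sum, map_smul, smul_eq_mul, map_zero] at hφsum
  rwa [Finset.sum_coe_sort (Finset.univ.erase i) fun j => N j ω * φ (v j),
    Finset.sum_erase_add _ _ (Finset.mem_univ i)]

lemma ae_mul_notMem_setA {d : ℕ} (hd : 3 ≤ d) {N : Fin d → Ω → ℝ}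
    (hN : ∀ i, AEMeasurable (N i) P) (hind : iIndepFun N P) {c : Fin d → ℝ} {i : Fin d}
    (hc : c i ≠ 0) [NullSingletonClass (P.map (N i))] :
    ∀ᵐ ω ∂P, (fun j => c j * N j ω) ∉ setA d := by
  have hv : c i • Complex.exp (-(Complex.I * freq d 1)) ^ ((i : ℕ) + 1) ≠ 0 :=
    smul_ne_zero hc (pow_ne_zero _ (Complex.exp_ne_zero _))
  have h1 : 1 ∈ Finset.Icc 1 (numFreq d) := by
    rw [Finset.mem_Icc, numFreq]
    omega
  filter_upwards [ae_sum_smul_ne_zero hN hind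
    (v := fun j => c j • Complex.exp (-(Complex.I * freq d 1)) ^ ((j : ℕ) + 1)) hv] with ω hω hA
  refine hω ?_
  simpa only [fourierSum, Fintype.linearCombination_apply, smul_smul, mul_comm (c _)]
    using mem_setA_iff.1 hA 1 h1

end Atomless

section ZeroOneValued

variable {Ω : Type*} [MeasurableSpace Ω] {P : Measure Ω} {X X' : Ω → ℝ}

lemma memLp_of_ae_eq_zero_or_one [IsFiniteMeasure P] (hX : AEMeasurable X P)
    (h : ∀ᵐ ω ∂P, X ω = 0 ∨ X ω = 1) (q : ENNReal) : MemLp X q P :=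
  .of_bound hX.aestronglyMeasurable 1 <| h.mono fun ω hω => by rcases hω with h | h <;> simp [h]

lemma measureReal_eq_zero_eq_one_sub [IsProbabilityMeasure P] (hX : AEMeasurable X P)
    (h : ∀ᵐ ω ∂P, X ω = 0 ∨ X ω = 1) :
    P.real {ω | X ω = 0} = 1 - P.real {ω | X ω = 1} := by
  rw [← integral_one_sub_of_ae_eq_zero_or_one hX h, ← integral_of_ae_eq_zero_or_one hX h,
    integral_sub (integrable_const 1) ((memLp_of_ae_eq_zero_or_one hX h 1).integrable le_rfl)]
  simp

lemma map_eq_of_measureReal_eq_one [IsProbabilityMeasure P] (hX : AEMeasurable X P)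
    (hX' : AEMeasurable X' P) (h : ∀ᵐ ω ∂P, X ω = 0 ∨ X ω = 1)
    (h' : ∀ᵐ ω ∂P, X' ω = 0 ∨ X' ω = 1)
    (heq : P.real {ω | X ω = 1} = P.real {ω | X' ω = 1}) : P.map X = P.map X' := by
  have h1 : P (X ⁻¹' {1}) = P (X' ⁻¹' {1}) := (measureReal_eq_measureReal_iff).1 heq
  have h0 : P (X ⁻¹' {0}) = P (X' ⁻¹' {0}) := (measureReal_eq_measureReal_iff).1 <|
    (measureReal_eq_zero_eq_one_sub hX h).trans <|
      heq ▸ (measureReal_eq_zero_eq_one_sub hX' h').symm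
  rw [(Measure.ae_eq_or_eq_iff_map_eq_dirac_add_dirac hX zero_ne_one).1 h,
    (Measure.ae_eq_or_eq_iff_map_eq_dirac_add_dirac hX' zero_ne_one).1 h', h0, h1]

lemma variance_ne_zero_of_ae_eq_zero_or_one [IsProbabilityMeasure P] (hX : AEMeasurable X P)
    (h : ∀ᵐ ω ∂P, X ω = 0 ∨ X ω = 1) (hp : P.real {ω | X ω = 1} ∈ Set.Ioo (0 : ℝ) 1) :
    Var[X; P] ≠ 0 := by
  rw [variance_of_ae_eq_zero_or_one hX h, measureReal_eq_zero_eq_one_sub hX h]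
  exact mul_ne_zero (sub_pos.2 hp.2).ne' hp.1.ne'

end ZeroOneValued

section Blocks

variable {Ω : Type*} [MeasurableSpace Ω] {P : Measure Ω} {Y : ℕ → Ω → ℝ} {r d : ℕ}

lemma periodic_integral_of_periodic_map (hY : ∀ l, AEMeasurable (Y (l + 1)) P)
    (hlaw : Function.Periodic (fun l => P.map (Y (l + 1))) r) :
    Function.Periodic (fun l => P[Y (l + 1)]) r := fun l =>
  IdentDistrib.integral_eq ⟨hY (l + r), hY l, hlaw l⟩

lemma periodic_variance_of_periodic_map (hY : ∀ l, AEMeasurable (Y (l + 1)) P)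
    (hlaw : Function.Periodic (fun l => P.map (Y (l + 1))) r) :
    Function.Periodic (fun l => Var[Y (l + 1); P]) r := fun l =>
  IdentDistrib.variance_eq ⟨hY (l + r), hY l, hlaw l⟩

lemma iIndepFun_blocks (hind : iIndepFun (fun l => Y (l + 1)) P) (hd : d ≠ 0) :
    iIndepFun (fun q : Fin d × ℕ => Y ((q.1 : ℕ) + 1 + q.2 * d)) P := by
  have := NeZero.mk hd
  convert hind.precomp ((Nat.divModEquiv d).symm.injective.comp Prod.swap_injective) using 2
  simp only [Function.comp_apply, Nat.divModEquiv_symm_apply, Prod.fst_swap, Prod.snd_swap]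
  exact congrArg Y (by ring)

lemma tendstoInMeasure_blockMean [IsFiniteMeasure P] (hL : ∀ l, MemLp (Y (l + 1)) 2 P)
    (hind : iIndepFun (fun l => Y (l + 1)) P) {p : ℕ → ℝ} (hmean : ∀ l, P[Y (l + 1)] = p (l + 1))
    (hp : Function.Periodic (fun l => p (l + 1)) r)
    (hvar : Function.Periodic (fun l => Var[Y (l + 1); P]) r) (hr : 0 < r) (hd : d ≠ 0)
    (i : Fin d) :
    TendstoInMeasure P (fun n => blockMean Y d n ((i : ℕ) + 1)) atTop
      fun _ => limMean p r d ((i : ℕ) + 1) := by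
  have hidx : ∀ k, (i : ℕ) + 1 + k * d = i + k * d + 1 := fun k => add_right_comm _ _ _
  refine (tendstoInMeasure_average (X := fun k => Y ((i : ℕ) + 1 + k * d))
    (fun k => hidx k ▸ hL _) (fun j k hjk => ?_) ?_
    (tendsto_average_of_periodic
      (periodic_apply_add_mul (u := fun l => Var[Y l; P]) hvar i d) hr)).comp
    (Nat.tendsto_div_const_atTop hd)
  · exact (iIndepFun_blocks hind hd).indepFun (i := (i, j)) (j := (i, k))
      (by simpa using hjk)
  · have hXmean : ∀ k, P[Y ((i : ℕ) + 1 + k * d)] = p ((i : ℕ) + 1 + k * d) := fun k => by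
      rw [hidx, hmean]
    simp only [hXmean]
    exact tendsto_average_of_periodic (periodic_apply_add_mul hp i d) hr

variable {Ω' : Type*} [MeasurableSpace Ω'] {P' : Measure Ω'} {N : Fin d → Ω' → ℝ}

lemma ae_sqrt_variance_mul_notMem_setA (hd : 3 ≤ d)
    (hvar : Function.Periodic (fun l => Var[Y (l + 1); P]) d) (hne : ∃ l, Var[Y (l + 1); P] ≠ 0)
    (hN : ∀ i, HasLaw (N i) (gaussianReal 0 1) P') (hNi : iIndepFun N P') :
    ∀ᵐ ω ∂P', (fun i : Fin d => √(Var[Y ((i : ℕ) + 1); P]) * N i ω) ∉ setA d := by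
  obtain ⟨l, hl⟩ := hne
  have hld : Var[Y (l % d + 1); P] ≠ 0 := by rwa [hvar.map_mod_nat l]
  let i : Fin d := ⟨l % d, Nat.mod_lt l (by omega)⟩
  have : NullSingletonClass (P'.map (N i)) := by
    rw [(hN i).map_eq]
    exact nullSingletonClass_gaussianReal one_ne_zero
  exact ae_mul_notMem_setA (i := i) hd (fun i => (hN i).aemeasurable) hNi
    ((Real.sqrt_ne_zero (variance_nonneg _ _)).2 hld)

variable [IsProbabilityMeasure P] [IsProbabilityMeasure P']

lemma tendstoInDistribution_blockSum (hL : ∀ l, MemLp (Y (l + 1)) 2 P)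
    (hind : iIndepFun (fun l => Y (l + 1)) P)
    (hlaw : Function.Periodic (fun l => P.map (Y (l + 1))) d) (hd : d ≠ 0)
    (hN : ∀ i, HasLaw (N i) (gaussianReal 0 1) P') (hNi : iIndepFun N P') :
    TendstoInDistribution
      (fun (m : ℕ) ω (i : Fin d) => (√(m : ℝ))⁻¹ *
        (∑ k ∈ Finset.range m, Y ((i : ℕ) + 1 + k * d) ω - m * P[Y ((i : ℕ) + 1)]))
      atTop (fun ω i => √(Var[Y ((i : ℕ) + 1); P]) * N i ω) (fun _ => P) P' := by
  have hident : ∀ i k : ℕ, IdentDistrib (Y (i + 1 + k * d)) (Y (i + 1 + 0 * d)) P P := fun i k => by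
    rw [zero_mul, add_zero, add_right_comm]
    exact ⟨(hL _).aemeasurable, (hL _).aemeasurable, hlaw.nat_mul k i⟩
  simpa only [zero_mul, add_zero] using tendstoInDistribution_inv_sqrt_mul_sum_sub_pi
    (X := fun (i : Fin d) k => Y ((i : ℕ) + 1 + k * d)) (fun i => by simpa using hL i)
    (iIndepFun_blocks hind hd) (fun i => hident i) hN hNi

lemma tendstoInDistribution_testStat_blockSeries (hL : ∀ l, MemLp (Y (l + 1)) 2 P)
    (hind : iIndepFun (fun l => Y (l + 1)) P)
    (hlaw : Function.Periodic (fun l => P.map (Y (l + 1))) d) (hd : d ≠ 0)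
    (he : (fun i : Fin d => P[Y ((i : ℕ) + 1)]) ∈ setA d) (hne : ∃ l, Var[Y (l + 1); P] ≠ 0)
    (hN : ∀ i, HasLaw (N i) (gaussianReal 0 1) P') (hNi : iIndepFun N P') :
    TendstoInDistribution (fun n ω => testStat (blockSeries Y d n ω)) atTop
      (fun ω => fisherG fun i : Fin d => √(Var[Y ((i : ℕ) + 1); P]) * N i ω) (fun _ => P) P' := by
  simp_rw [testStat_blockSeries_eq he]
  refine tendstoInDistribution_comp_of_ae_continuousAt measurable_fisherG
    (tendstoInDistribution_comp_tendsto (tendstoInDistribution_blockSum hL hind hlaw hd hN hNi)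
      (Nat.tendsto_div_const_atTop hd)) ?_
  rcases Nat.lt_or_ge d 3 with h3 | h3
  · have hg : (fisherG : (Fin d → ℝ) → ℝ) = fun _ => 0 := funext (fisherG_eq_zero_of_lt_three h3)
    exact .of_forall fun ω => hg ▸ continuousAt_const
  · have hvar := periodic_variance_of_periodic_map (fun l => (hL l).aemeasurable) hlaw
    exact (ae_sqrt_variance_mul_notMem_setA h3 hvar hne hN hNi).mono fun ω => continuousAt_fisherG

lemma tendstoInMeasure_testStat_blockSeries {p : ℕ → ℝ} (hL : ∀ l, MemLp (Y (l + 1)) 2 P)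
    (hind : iIndepFun (fun l => Y (l + 1)) P) (hmean : ∀ l, P[Y (l + 1)] = p (l + 1))
    (hp : Function.Periodic (fun l => p (l + 1)) r)
    (hvar : Function.Periodic (fun l => Var[Y (l + 1); P]) r) (hr : 0 < r) (hd : d ≠ 0)
    (he : limSeries p r d ∉ setA d) :
    TendstoInMeasure P (fun n ω => testStat (blockSeries Y d n ω)) atTop
      fun _ => fisherG (limSeries p r d) := by
  simp_rw [testStat_eq_fisherG]
  exact tendstoInMeasure_comp_of_continuousAt (continuousAt_fisherG he)
    (tendstoInMeasure_blockMean hL hind hmean hp hvar hr hd)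

end Blocks

end PeriodTest

open PeriodTest in
theorem mainTheorem4_general
    {Ω : Type*} [MeasurableSpace Ω] (P : Measure Ω) [IsProbabilityMeasure P]
    (Y : ℕ → Ω → ℝ) (p : ℕ → ℝ) (r d : ℕ)
    (hYL : ∀ l, MemLp (Y (l + 1)) 2 P)
    (hYindep : iIndepFun (fun l : ℕ => Y (l + 1)) P)
    (hYmean : ∀ l, P[Y (l + 1)] = p (l + 1))
    (hYlaw : Function.Periodic (fun l => P.map (Y (l + 1))) r)
    (hd : 1 ≤ d) :
    (r = 2 → 2 ∣ d → (∃ l, Var[Y (l + 1); P] ≠ 0) →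
      limSeries p r d ∈ setA d ∧
      ∀ {Ω' : Type*} [MeasurableSpace Ω'] (P' : Measure Ω') [IsProbabilityMeasure P']
        (N : Fin d → Ω' → ℝ),
        (∀ i, HasLaw (N i) (gaussianReal 0 1) P') → iIndepFun N P' →
        (3 ≤ d → ∀ᵐ ω ∂P',
          altScale (√(limVar P Y r d 1)) (√(limVar P Y r d 2))
            (fun i => N i ω) ∉ setA d) ∧
        TendstoInDistribution
          (fun (n : ℕ) ω => testStat (blockSeries Y d n ω)) atTop
          (fun ω => fisherG
            (altScale (√(limVar P Y r d 1)) (√(limVar P Y r d 2))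
              (fun i => N i ω)))
          (fun _ => P) P') ∧
    (3 ≤ Nat.gcd r d →
      ∑ k ∈ Finset.Icc 1 r,
        (limMean p r d k : ℂ) *
          Complex.exp (-(2 * (Real.pi : ℂ) * Complex.I * (k : ℂ) / (Nat.gcd r d : ℂ))) *
          ((⌊((d : ℝ) - (k : ℝ)) / (r : ℝ)⌋ + 1 : ℤ) : ℂ) ≠ 0 →
      limSeries p r d ∉ setA d ∧
      TendstoInMeasure P
        (fun (n : ℕ) ω => testStat (blockSeries Y d n ω)) atTop
        (fun _ => fisherG (limSeries p r d))) := by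
  have hYm : ∀ l, AEMeasurable (Y (l + 1)) P := fun l => (hYL l).aemeasurable
  have hvar := periodic_variance_of_periodic_map hYm hYlaw
  have hp : Function.Periodic (fun l => p (l + 1)) r := by
    simpa only [hYmean] using periodic_integral_of_periodic_map hYm hYlaw
  refine ⟨?_, fun hb hsum => ?_⟩
  · rintro rfl h2d hne
    have hA := limSeries_two_mem_setA hp h2d
    have hlim : limSeries p 2 d = fun i : Fin d => P[Y (i + 1)] := funext fun i =>
      (limMean_eq_of_dvd hp two_ne_zero h2d i).trans (hYmean i).symm
    refine ⟨hA, fun P' _ N hN hNi => ?_⟩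
    simp only [altScale_sqrt_limVar (P := P) (Y := Y) hvar h2d]
    exact ⟨fun h3 => ae_sqrt_variance_mul_notMem_setA h3 (periodic_of_dvd hvar h2d) hne hN hNi,
      tendstoInDistribution_testStat_blockSeries hYL hYindep (periodic_of_dvd hYlaw h2d) (by omega)
        (hlim ▸ hA) hne hN hNi⟩
  · have hA := limSeries_notMem_setA hp (by omega) hb hsum
    have hr : 0 < r := Nat.pos_of_ne_zero <| by
      rintro rfl
      exact hsum (by simp)
    exact ⟨hA, tendstoInMeasure_testStat_blockSeries hYL hYindep hYmean hp hvar hr (by omega) hA⟩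

theorem mainTheorem4
    {Ω : Type*} [MeasurableSpace Ω] (P : Measure Ω) [IsProbabilityMeasure P]
    (Y : ℕ → Ω → ℝ) (p : ℕ → ℝ) (r d : ℕ)
    (hYmeas : ∀ l, 1 ≤ l → Measurable (Y l))
    (hYbin : ∀ l, 1 ≤ l → ∀ ω, Y l ω = 0 ∨ Y l ω = 1)
    (hYindep : iIndepFun (fun l : ℕ => Y (l + 1)) P)
    (hYp : ∀ l, 1 ≤ l → P.real {ω | Y l ω = 1} = p l)
    (hp : ∀ l, 1 ≤ l → p l ∈ Set.Ioo (0 : ℝ) 1)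
    (hr : PeriodTest.IsMinimalPeriod p r)
    (hd : 1 ≤ d)
    (hrd : 1 < Nat.gcd r d) :
    (r = 2 →
      PeriodTest.limSeries p r d ∈ PeriodTest.setA d ∧
      ∀ {Ω' : Type*} [MeasurableSpace Ω'] (P' : Measure Ω') [IsProbabilityMeasure P']
        (N : Fin d → Ω' → ℝ),
        (∀ i, HasLaw (N i) (gaussianReal 0 1) P') → iIndepFun N P' →
        (3 ≤ d → ∀ᵐ ω ∂P',
          PeriodTest.altScale (√(PeriodTest.limVar P Y r d 1)) (√(PeriodTest.limVar P Y r d 2))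
            (fun i => N i ω) ∉ PeriodTest.setA d) ∧
        TendstoInDistribution
          (fun (n : ℕ) ω => PeriodTest.testStat (PeriodTest.blockSeries Y d n ω)) atTop
          (fun ω => PeriodTest.fisherG
            (PeriodTest.altScale (√(PeriodTest.limVar P Y r d 1)) (√(PeriodTest.limVar P Y r d 2))
              (fun i => N i ω)))
          (fun _ => P) P') ∧
    (3 ≤ r → 3 ≤ Nat.gcd r d →
      ∑ k ∈ Finset.Icc 1 r,
        (PeriodTest.limMean p r d k : ℂ) *
          Complex.exp (-(2 * (Real.pi : ℂ) * Complex.I * (k : ℂ) / (Nat.gcd r d : ℂ))) *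
          ((⌊((d : ℝ) - (k : ℝ)) / (r : ℝ)⌋ + 1 : ℤ) : ℂ) ≠ 0 →
      PeriodTest.limSeries p r d ∉ PeriodTest.setA d ∧
      TendstoInMeasure P
        (fun (n : ℕ) ω => PeriodTest.testStat (PeriodTest.blockSeries Y d n ω)) atTop
        (fun _ => PeriodTest.fisherG (PeriodTest.limSeries p r d))) := by
  have hpos : ∀ l : ℕ, 1 ≤ l + 1 := Nat.le_add_left 1
  have hYm : ∀ l, AEMeasurable (Y (l + 1)) P := fun l => (hYmeas _ (hpos l)).aemeasurable
  have hY01 : ∀ l, ∀ᵐ ω ∂P, Y (l + 1) ω = 0 ∨ Y (l + 1) ω = 1 := fun l =>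
    .of_forall (hYbin _ (hpos l))
  have hYprob : ∀ l, P.real {ω | Y (l + 1) ω = 1} = p (l + 1) := fun l => hYp _ (hpos l)
  obtain ⟨ha, hb⟩ := mainTheorem4_general P Y p r d
    (fun l => PeriodTest.memLp_of_ae_eq_zero_or_one (hYm l) (hY01 l) 2) hYindep
    (fun l => by rw [integral_of_ae_eq_zero_or_one (hYm l) (hY01 l), hYprob])
    (fun l => PeriodTest.map_eq_of_measureReal_eq_one (hYm _) (hYm _) (hY01 _) (hY01 _) <| by
      rw [hYprob, hYprob, ← hr.1.2 (l + 1) 1 (hpos l), one_mul, add_assoc, add_left_comm]) hd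
  exact ⟨fun hr2 => ha hr2 (Nat.prime_two.dvd_iff_not_coprime.2 (hr2 ▸ hrd.ne'))
    ⟨0, PeriodTest.variance_ne_zero_of_ae_eq_zero_or_one (hYm 0) (hY01 0)
      (hYprob 0 ▸ hp _ le_rfl)⟩, fun _ => hb⟩
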